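/- Let $\Bbbk$ be an algebraically closed field, $n\ge 0$ an integer, and $T$ an irreducible algebraic variety over $\Bbbk$ (an integral separated scheme of finite type over $\Bbbk$, with its Zariski topology on $\Bbbk$-points). An algebraic family (or morphism) $\varphi:T\to\mathrm{Bir}(\mathbb P^n)$ is given by a birational map $T\times\mathbb P^n\dashrightarrow T\times\mathbb P^n$ for which there are a dense open set $U\subset T\times\mathbb P^n$ and a morphism $f:U\to\mathbb P^n$ such that, for every $t\in T$, the set $U_t=U\cap(\{t\}\times\mathbb P^n)$ is dense in $\{t\}\times\mathbb P^n$, the map is $(t,x)\mapsto(t,f(t,x))$ on $U$, and $\varphi_t:=f(t,\cdot)$ is a birational map of $\mathbb P^n$. Let $\deg(\varphi_t)$ be the minimal degree of homogeneous polynomials $F_0,\dots,F_n\in\Bbbk[x_0,\dots,x_n]$ of the same degree with $\varphi_t=(F_0:\cdots:F_n)$ on a nonempty open set. A writing of $\varphi$ of degree $d$ on a nonempty affine open set $V\subset T$ is a tuple $(f_0,\dots,f_n)$ of elements of $\Bbbk[V]\otimes\Bbbk[x_0,\dots,x_n]$, homogeneous of degree $d$ in $x_0,\dots,x_n$, with $\varphi(t,x)=(f_0(t,x):\cdots:f_n(t,x))$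 for all $(t,x)$ in a nonempty open subset of $U\cap(V\times\mathbb P^n)$; let $\mathrm{Deg}(\varphi)$ be the minimal degree of the writings of $\varphi$ on all such $V$. Then: 1. There is a finite stratification $T=\bigcup_{j=1}^{\ell}V_j$ into nonempty, pairwise disjoint, locally closed sets such that $\deg(\varphi_t)$ is constant on each $V_j$. 2. The function $T\to\mathbb N$, $t\mapsto\deg(\varphi_t)$, is lower semicontinuous. 3. $\deg(\varphi_t)\le\mathrm{Deg}(\varphi)$ for every $t\in T$. 4. The set $U_\varphi=\{t\in T:\deg(\varphi_t)=\mathrm{Deg}(\varphi)\}$ is a nonempty open subset of $T$. -/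

import Mathlib

open CategoryTheory AlgebraicGeometry

universe u

noncomputable section

namespace Cremona

/-! ## Projective space over a field, and rational self-maps of it -/

/-- The set of points of the projective space of dimension `n` over the field `k`. -/
def PSpace (k : Type u) [Field k] (n : ℕ) : Type u :=
  Projectivization k (Fin (n + 1) → k)

section PSpace

variable {k : Type u} [Field k] {n : ℕ}

/-- A representative of `x` by homogeneous coordinates. -/
def PSpace.coords (x : PSpace k n) : Fin (n + 1) → k := Projectivization.rep x

/-- A tuple of polynomials all of whose entries are homogeneous of degree `d`. -/
def IsHomogeneousTuple {R : Type u} [CommRing R]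
    (F : Fin (n + 1) → MvPolynomial (Fin (n + 1)) R) (d : ℕ) : Prop :=
  ∀ i, (F i).IsHomogeneous d

/-- `y = (F₀(x) : ⋯ : Fₙ(x))`; this includes that the `Fᵢ(x)` do not all vanish.
For `F` homogeneous of some degree this does not depend on the choice of coordinates of `x`. -/
def RepresentsAt (F : Fin (n + 1) → MvPolynomial (Fin (n + 1)) k) (x y : PSpace k n) : Prop :=
  ∃ h : (fun i => MvPolynomial.eval x.coords (F i)) ≠ 0, y = Projectivization.mk k _ h

/-- The Zariski topology on projective space: the sets `{x | G x ≠ 0}` with `G` homogeneous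
form a basis of open sets. -/
instance : TopologicalSpace (PSpace k n) :=
  TopologicalSpace.generateFrom
    {B | ∃ (d : ℕ) (G : MvPolynomial (Fin (n + 1)) k), G.IsHomogeneous d ∧
      B = {x | MvPolynomial.eval x.coords G ≠ 0}}

/-- `f` is a morphism to projective space on the open set `U`: locally on `U`, it is given by
homogeneous polynomials of the same degree without common zero. -/
def IsRegularOn (f : PSpace k n → PSpace k n) (U : Set (PSpace k n)) : Prop :=
  ∀ x ∈ U, ∃ W ⊆ U, x ∈ W ∧ IsOpen W ∧
    ∃ (d : ℕ) (F : Fin (n + 1) → MvPolynomial (Fin (n + 1)) k), IsHomogeneousTuple F d ∧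
      ∀ y ∈ W, RepresentsAt F y (f y)

end PSpace

/-- (A representative of) a rational map from `ℙⁿ` to itself: a morphism on a dense open set.
The values of `toFun` outside `domain` are irrelevant. -/
structure RationalSelfMap (k : Type u) [Field k] (n : ℕ) where
  domain : Set (PSpace k n)
  isOpen_domain : IsOpen domain
  dense_domain : Dense domain
  toFun : PSpace k n → PSpace k n
  isRegularOn : IsRegularOn toFun domain

namespace RationalSelfMap

variable {k : Type u} [Field k] {n : ℕ}

/-- A rational map is birational if it restricts to an isomorphism between dense open sets. -/
def IsBirational (f : RationalSelfMap k n) : Prop :=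
  ∃ (U W : Set (PSpace k n)) (g : PSpace k n → PSpace k n),
    U ⊆ f.domain ∧ IsOpen U ∧ Dense U ∧ IsOpen W ∧ Dense W ∧ IsRegularOn g W ∧
      Set.MapsTo f.toFun U W ∧ Set.MapsTo g W U ∧ Set.InvOn g f.toFun U W

/-- The homogeneous polynomials `F₀, …, Fₙ` of degree `d` define the rational map `f`, that is,
`f(x) = (F₀(x) : ⋯ : Fₙ(x))` for all `x` in a nonempty open set. -/
def IsDefinedBy (f : RationalSelfMap k n)
    (F : Fin (n + 1) → MvPolynomial (Fin (n + 1)) k) (d : ℕ) : Prop :=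
  IsHomogeneousTuple F d ∧
    ∃ W ⊆ f.domain, IsOpen W ∧ W.Nonempty ∧ ∀ x ∈ W, RepresentsAt F x (f.toFun x)

/-- The degree of a rational map: the minimal degree of homogeneous polynomials defining it. -/
def degree (f : RationalSelfMap k n) : ℕ :=
  sInf {d | ∃ F, f.IsDefinedBy F d}

end RationalSelfMap

/-! ## Points and functions of a variety `s : T ⟶ Spec k` -/

/-- The `k`-points of the `k`-scheme `s : T ⟶ Spec k`. For `k` algebraically closed and `s` locally
of finite type these are the closed points of `T`, that is, the points of the variety `T`. -/
def Points {k : Type u} [Field k] {T : Scheme.{u}} (s : T ⟶ Spec (.of k)) : Type u :=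
  {t : Spec (.of k) ⟶ T // t ≫ s = 𝟙 _}

section Points

variable {k : Type u} [Field k] {T : Scheme.{u}} {s : T ⟶ Spec (.of k)}

/-- The point of the underlying space of `T` at which a `k`-point is located. -/
def Points.pt (t : Points s) : T := t.1 (IsLocalRing.closedPoint k)

/-- The Zariski topology on the set of `k`-points. -/
instance : TopologicalSpace (Points s) :=
  TopologicalSpace.induced Points.pt inferInstance

/-- A morphism from `Spec k` factors through every open set that contains its image. -/
theorem Points.top_le_preimage (t : Points s) {V : T.Opens} (h : t.pt ∈ V) :
    (⊤ : (Spec (.of k)).Opens) ≤ t.1 ⁻¹ᵁ V := by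
  intro x _
  have hx : x = IsLocalRing.closedPoint k := Subsingleton.elim (α := PrimeSpectrum k) _ _
  subst hx
  exact h

/-- The value `a(t) ∈ k` of a function `a` on the open set `V` at a `k`-point `t` of `V`. -/
def evalAt (t : Points s) (V : T.Opens) (h : t.pt ∈ V) : Γ(T, V) →+* k :=
  (t.1.appLE V ⊤ (t.top_le_preimage h) ≫ (Scheme.ΓSpecIso (.of k)).hom).hom

/-- The polynomial over `k` got from a polynomial with coefficients in the functions on `V`
by evaluating the coefficients at a `k`-point `t` of `V`. -/
def specialize {n : ℕ} (t : Points s) (V : T.Opens) (h : t.pt ∈ V)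
    (G : MvPolynomial (Fin (n + 1)) Γ(T, V)) : MvPolynomial (Fin (n + 1)) k :=
  MvPolynomial.map (evalAt t V h) G

end Points

/-! ## The product `T × ℙⁿ` -/

/-- The points of the variety `T × ℙⁿ`. -/
@[ext]
structure RelPSpace {k : Type u} [Field k] {T : Scheme.{u}} (s : T ⟶ Spec (.of k)) (n : ℕ) where
  base : Points s
  fib : PSpace k n

section RelPSpace

variable {k : Type u} [Field k] {T : Scheme.{u}} {s : T ⟶ Spec (.of k)} {n : ℕ}

/-- The Zariski topology on `T × ℙⁿ` (not the product topology): the sets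
`{(t, x) | t ∈ V, G(t, x) ≠ 0}` with `V ⊆ T` open and `G` a homogeneous polynomial with
coefficients in the functions on `V` form a basis of open sets. -/
instance : TopologicalSpace (RelPSpace s n) :=
  TopologicalSpace.generateFrom
    {B | ∃ (V : T.Opens) (d : ℕ) (G : MvPolynomial (Fin (n + 1)) Γ(T, V)), G.IsHomogeneous d ∧
      B = {p | ∃ h : p.base.pt ∈ V,
        MvPolynomial.eval p.fib.coords (specialize p.base V h G) ≠ 0}}

/-- `f(t, x) = (F₀(t, x) : ⋯ : Fₙ(t, x))` for all points `(t, x)` of the set `W`, which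
lies over the open set `V` on which the coefficients of the `Fᵢ` are defined. -/
def RepresentsOn (f : RelPSpace s n → PSpace k n) (W : Set (RelPSpace s n)) (V : T.Opens)
    (F : Fin (n + 1) → MvPolynomial (Fin (n + 1)) Γ(T, V)) : Prop :=
  ∀ p ∈ W, ∃ h : p.base.pt ∈ V,
    RepresentsAt (fun i => specialize p.base V h (F i)) p.fib (f p)

/-- `f` is a morphism from the open set `U ⊆ T × ℙⁿ` to `ℙⁿ`: locally on `U`, it is given by
polynomials that are homogeneous of the same degree in the coordinates of `ℙⁿ`, with functions
on an open set of `T` as coefficients, and have no common zero. -/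
def IsRelRegularOn (f : RelPSpace s n → PSpace k n) (U : Set (RelPSpace s n)) : Prop :=
  ∀ p ∈ U, ∃ W ⊆ U, p ∈ W ∧ IsOpen W ∧
    ∃ (V : T.Opens) (d : ℕ) (F : Fin (n + 1) → MvPolynomial (Fin (n + 1)) Γ(T, V)),
      IsHomogeneousTuple F d ∧ RepresentsOn f W V F

/-- The self-map `(t, x) ↦ (t, f(t, x))` of `T × ℙⁿ` over `T`. -/
def overMap (f : RelPSpace s n → PSpace k n) (p : RelPSpace s n) : RelPSpace s n :=
  ⟨p.base, f p⟩

/-- The section `U_t` of a set `U ⊆ T × ℙⁿ` over `t`. -/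
def section_ (U : Set (RelPSpace s n)) (t : Points s) : Set (PSpace k n) :=
  {x | (⟨t, x⟩ : RelPSpace s n) ∈ U}

theorem isHomogeneous_specialize (t : Points s) (V : T.Opens) (h : t.pt ∈ V)
    {G : MvPolynomial (Fin (n + 1)) Γ(T, V)} {d : ℕ} (hG : G.IsHomogeneous d) :
    (specialize t V h G).IsHomogeneous d :=
  hG.map _

theorem isOpen_section {U : Set (RelPSpace s n)} (hU : IsOpen U) (t : Points s) :
    IsOpen (section_ U t) := by
  have hc : Continuous (fun x : PSpace k n => (⟨t, x⟩ : RelPSpace s n)) := by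
    refine continuous_generateFrom_iff.2 ?_
    rintro B ⟨V, d, G, hG, rfl⟩
    by_cases h : t.pt ∈ V
    · refine TopologicalSpace.isOpen_generateFrom_of_mem
        ⟨d, specialize t V h G, isHomogeneous_specialize t V h hG, ?_⟩
      ext x
      exact ⟨fun ⟨_, hx⟩ => hx, fun hx => ⟨h, hx⟩⟩
    · convert isOpen_empty
      ext x
      exact ⟨fun ⟨hx, _⟩ => h hx, fun hx => hx.elim⟩
  exact hU.preimage hc

theorem isRegularOn_section {f : RelPSpace s n → PSpace k n} {U : Set (RelPSpace s n)}
    (hf : IsRelRegularOn f U) (t : Points s) :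
    IsRegularOn (fun x => f ⟨t, x⟩) (section_ U t) := by
  intro x hx
  obtain ⟨W, hWU, hxW, hW, V, d, F, hF, hR⟩ := hf _ hx
  obtain ⟨h, -⟩ := hR _ hxW
  refine ⟨section_ W t, fun y hy => hWU hy, hxW, isOpen_section hW t, d,
    fun i => specialize t V h (F i), fun i => isHomogeneous_specialize t V h (hF i), ?_⟩
  intro y hy
  obtain ⟨_, hy'⟩ := hR _ hy
  exact hy'

end RelPSpace

/-! ## Algebraic families -/

/-- (A representative of) a family of rational self-maps of `ℙⁿ`, parametrized by `T`: a morphism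
`f` to `ℙⁿ` on a dense open set `U ⊆ T × ℙⁿ` such that `U_t` is dense in `{t} × ℙⁿ` for all
`t`. The values of `toFun` outside `domain` are irrelevant. -/
structure RationalFamily {k : Type u} [Field k] {T : Scheme.{u}} (s : T ⟶ Spec (.of k))
    (n : ℕ) where
  domain : Set (RelPSpace s n)
  isOpen_domain : IsOpen domain
  dense_domain : Dense domain
  toFun : RelPSpace s n → PSpace k n
  isRegularOn : IsRelRegularOn toFun domain
  dense_section : ∀ t : Points s, Dense (section_ domain t)

namespace RationalFamily

variable {k : Type u} [Field k] {T : Scheme.{u}} {s : T ⟶ Spec (.of k)} {n : ℕ}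

/-- The rational map `φ_t : x ↦ f(t, x)`. -/
def fiber (φ : RationalFamily s n) (t : Points s) : RationalSelfMap k n where
  domain := section_ φ.domain t
  isOpen_domain := isOpen_section φ.isOpen_domain t
  dense_domain := φ.dense_section t
  toFun x := φ.toFun ⟨t, x⟩
  isRegularOn := isRegularOn_section φ.isRegularOn t

/-- The rational map `(t, x) ↦ (t, f(t, x))` from `T × ℙⁿ` to itself is birational: it restricts
to an isomorphism between dense open sets (whose inverse is a map over `T`, too). -/
def IsBirational (φ : RationalFamily s n) : Prop :=
  ∃ (U W : Set (RelPSpace s n)) (g : RelPSpace s n → PSpace k n),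
    U ⊆ φ.domain ∧ IsOpen U ∧ Dense U ∧ IsOpen W ∧ Dense W ∧ IsRelRegularOn g W ∧
      Set.MapsTo (overMap φ.toFun) U W ∧ Set.MapsTo (overMap g) W U ∧
      Set.InvOn (overMap g) (overMap φ.toFun) U W

/-- `w = (F₀, …, Fₙ)` is a writing of degree `d` of `φ` on the affine open set `V`: the `Fᵢ` are
homogeneous polynomials of degree `d` with coefficients in the functions on `V`, and
`φ(t, x) = (F₀(t, x) : ⋯ : Fₙ(t, x))` for all `(t, x)` in a nonempty open subset of `V × ℙⁿ`. -/
def IsWriting (φ : RationalFamily s n) (V : T.Opens)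
    (F : Fin (n + 1) → MvPolynomial (Fin (n + 1)) Γ(T, V)) (d : ℕ) : Prop :=
  IsAffineOpen V ∧ IsHomogeneousTuple F d ∧
    ∃ W ⊆ φ.domain, IsOpen W ∧ W.Nonempty ∧ RepresentsOn φ.toFun W V F

/-- The degree `Deg(φ)` of a family: the minimal degree of its writings on the nonempty affine
open sets of `T`. -/
def Deg (φ : RationalFamily s n) : ℕ :=
  sInf {d | ∃ (V : T.Opens) (F : Fin (n + 1) → MvPolynomial (Fin (n + 1)) Γ(T, V)),
    (V : Set T).Nonempty ∧ φ.IsWriting V F d}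

end RationalFamily

/-- (A representative of) an algebraic family `T → Bir(ℙⁿ)`, that is, of a pseudo-automorphism of
`T × ℙⁿ` over `T`: the rational map `(t, x) ↦ (t, f(t, x))` of `T × ℙⁿ` is birational, and
so is the rational map `φ_t` for every `t`. -/
structure AlgebraicFamily {k : Type u} [Field k] {T : Scheme.{u}} (s : T ⟶ Spec (.of k))
    (n : ℕ) extends RationalFamily s n where
  isBirational : toRationalFamily.IsBirational
  isBirational_fiber : ∀ t : Points s, (toRationalFamily.fiber t).IsBirational

end Cremona

end

noncomputable section

namespace Cremona

/-! ## Linear systems over a domain -/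

/-! Near any parameter `t₀`, a single tuple `g` with coefficients in `Γ(T, V)` defines `φ_t` for
every `t` in `V`. Another homogeneous tuple `F` defines `φ_t` exactly when it is nonzero and
proportional to the specialization of `g`. So `deg φ_t ≤ d` says that a homogeneous linear system in
the coefficients of `F` has a nonzero solution. Over a domain this means that all maximal minors
vanish (`hasProportional_iff`), and minors commute with specialization. Hence `deg φ_t ≤ d` is a
closed condition on `t`, which is lower semicontinuity.

The same criterion over the domain `Γ(T, V)` governs writings. If `deg φ_t ≤ d` on `V`, the minors
vanish at all points, hence identically, and a solution over `Γ(T, V)` is a writing of degree `d`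
(`IsWritingOverAll.exists_isWriting`). Conversely, a writing bounds the degree on a nonempty open
set, hence everywhere by irreducibility (`IsWriting.degree_fiber_le`). So `Deg φ` is the maximum of
the `deg φ_t`, and the strata are the nonempty fibres of a bounded semicontinuous function. -/

/-- Over the fraction field, vanishing minors force the rows to span a proper subspace; a functional
killing it, cleared of denominators, is the solution. The set `ρ` of equations may be infinite. -/
theorem exists_ne_zero_forall_dotProduct_eq_zero_iff {R C ρ : Type*} [CommRing R] [IsDomain R]
    [Fintype C] [DecidableEq C] (v : ρ → C → R) :
    (∃ w : C → R, w ≠ 0 ∧ ∀ r, v r ⬝ᵥ w = 0) ↔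
      ∀ f : C → ρ, (Matrix.of fun c => v (f c)).det = 0 := by
  constructor
  · rintro ⟨w, hw, h⟩ f
    exact Matrix.exists_mulVec_eq_zero_iff.1 ⟨w, hw, funext fun c => h (f c)⟩
  intro h
  let K := FractionRing R
  let v' : ρ → C → K := fun r c => algebraMap R K (v r c)
  have hlt : Submodule.span K (Set.range v') < ⊤ := by
    rw [lt_top_iff_ne_top]
    intro htop
    -- If the rows spanned, a basis chosen among them would give a nonzero minor.
    obtain ⟨b, hb, hspan, hli⟩ := exists_linearIndependent K (Set.range v')
    let B : Module.Basis b K (C → K) := Module.Basis.mk hli (by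
      rw [Subtype.range_coe, hspan, htop])
    let e : C ≃ b := (Pi.basisFun K C).indexEquiv B
    choose f hf using fun c => hb (e c).2
    have hli' : LinearIndependent K (fun c => v' (f c)) := by
      have : (fun c => v' (f c)) = (fun x : b => (x : C → K)) ∘ e := funext hf
      rw [this]
      exact hli.comp _ e.injective
    have hu := Matrix.linearIndependent_rows_iff_isUnit.1
      (show LinearIndependent K (Matrix.of fun c => v' (f c)).row from hli')
    rw [Matrix.isUnit_iff_isUnit_det] at hu
    apply hu.ne_zero
    have := congrArg (algebraMap R K) (h f)
    rw [RingHom.map_det, map_zero] at this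
    exact this
  obtain ⟨φ, hφ, hker⟩ := Submodule.exists_le_ker_of_lt_top _ hlt
  obtain ⟨m, hm⟩ := IsLocalization.exist_integer_multiples_of_finite (nonZeroDivisors R)
    (fun c => φ (Pi.single c 1))
  choose w hw using hm
  have hinj : Function.Injective (algebraMap R K) := IsFractionRing.injective R K
  have hφv (x : C → K) : φ x = ∑ c, x c * φ (Pi.single c 1) := by
    conv_lhs => rw [pi_eq_sum_univ' x]
    simp
  refine ⟨w, ?_, fun r => hinj ?_⟩
  · rintro rfl
    apply hφ
    ext c
    have h1 := hw c
    rw [Pi.zero_apply, map_zero, eq_comm, Algebra.smul_def] at h1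
    have h2 : algebraMap R K m ≠ 0 := by
      rw [Ne, map_eq_zero_iff _ hinj]
      exact nonZeroDivisors.coe_ne_zero m
    simpa using (mul_eq_zero.1 h1).resolve_left h2
  · have h0 : φ (v' r) = 0 := hker (Submodule.subset_span ⟨r, rfl⟩)
    rw [map_zero, dotProduct, map_sum]
    calc _ = algebraMap R K m * φ (v' r) := by
          rw [hφv, Finset.mul_sum]
          refine Finset.sum_congr rfl fun c _ => ?_
          rw [map_mul, hw, Algebra.smul_def]
          ring
      _ = 0 := by rw [h0, mul_zero]

/-! ## Tuples of polynomials proportional to a given one -/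

section Proportional

variable {R S : Type u} [CommRing R] [CommRing S] {n : ℕ}

/-- There is a nonzero tuple of homogeneous polynomials of degree `d` proportional to `g`. -/
def HasProportional (g : Fin (n + 1) → MvPolynomial (Fin (n + 1)) R) (d : ℕ) : Prop :=
  ∃ F : Fin (n + 1) → MvPolynomial (Fin (n + 1)) R,
    IsHomogeneousTuple F d ∧ F ≠ 0 ∧ ∀ i j, F i * g j = F j * g i

/-- The index set of the coefficients of a tuple of homogeneous polynomials of degree `d`. -/
abbrev CoeffIndex (n d : ℕ) : Type :=
  Fin (n + 1) × {α // α ∈ Finset.finsuppAntidiag (Finset.univ : Finset (Fin (n + 1))) d}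

/-- The tuple of homogeneous polynomials with given coefficients. -/
def tupleOfCoeffs {d : ℕ} (w : CoeffIndex n d → R) (i : Fin (n + 1)) :
    MvPolynomial (Fin (n + 1)) R :=
  ∑ a, MvPolynomial.monomial a.1 (w (i, a))

theorem mem_finsuppAntidiag_univ {α : Fin (n + 1) →₀ ℕ} {d : ℕ} :
    α ∈ Finset.finsuppAntidiag Finset.univ d ↔ α.degree = d := by
  simp [Finset.mem_finsuppAntidiag, Finsupp.degree_eq_sum]

theorem isHomogeneousTuple_tupleOfCoeffs {d : ℕ} (w : CoeffIndex n d → R) :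
    IsHomogeneousTuple (tupleOfCoeffs w) d := fun _ =>
  MvPolynomial.IsHomogeneous.sum _ _ _ fun a _ =>
    MvPolynomial.isHomogeneous_monomial _ (mem_finsuppAntidiag_univ.1 a.2)

theorem coeff_tupleOfCoeffs {d : ℕ} (w : CoeffIndex n d → R) (c : CoeffIndex n d) :
    (tupleOfCoeffs w c.1).coeff c.2.1 = w c := by
  rw [tupleOfCoeffs, MvPolynomial.coeff_sum, Finset.sum_eq_single c.2]
  · simp
  · intro b _ hb
    rw [MvPolynomial.coeff_monomial, if_neg fun h => hb (Subtype.ext h)]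
  · simp

theorem tupleOfCoeffs_coeff {d : ℕ} {F : Fin (n + 1) → MvPolynomial (Fin (n + 1)) R}
    (hF : IsHomogeneousTuple F d) :
    tupleOfCoeffs (fun c : CoeffIndex n d => (F c.1).coeff c.2.1) = F := by
  funext i
  ext α
  by_cases hα : α ∈ Finset.finsuppAntidiag (Finset.univ : Finset (Fin (n + 1))) d
  · exact coeff_tupleOfCoeffs _ (i, ⟨α, hα⟩)
  · have hd : α.degree ≠ d := fun h => hα (mem_finsuppAntidiag_univ.2 h)
    rw [(hF i).coeff_eq_zero hd, (isHomogeneousTuple_tupleOfCoeffs _ i).coeff_eq_zero hd]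

/-- The linear equations for the coefficients of the tuples proportional to `g`. -/
def proportionalityEquation (g : Fin (n + 1) → MvPolynomial (Fin (n + 1)) R) (d : ℕ)
    (r : Fin (n + 1) × Fin (n + 1) × (Fin (n + 1) →₀ ℕ)) (c : CoeffIndex n d) : R :=
  ((MvPolynomial.monomial c.2.1 (1 : R)) *
    ((if c.1 = r.1 then g r.2.1 else 0) - (if c.1 = r.2.1 then g r.1 else 0))).coeff r.2.2

theorem proportionalityEquation_dotProduct (g : Fin (n + 1) → MvPolynomial (Fin (n + 1)) R)
    {d : ℕ} (w : CoeffIndex n d → R) (i j : Fin (n + 1)) (β : Fin (n + 1) →₀ ℕ) :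
    proportionalityEquation g d (i, j, β) ⬝ᵥ w =
      (tupleOfCoeffs w i * g j - tupleOfCoeffs w j * g i).coeff β := by
  have key (l : Fin (n + 1)) (p : MvPolynomial (Fin (n + 1)) R) :
      tupleOfCoeffs w l * p =
        ∑ c : CoeffIndex n d, w c •
          (MvPolynomial.monomial c.2.1 (1 : R) * (if c.1 = l then p else 0)) := by
    rw [Fintype.sum_prod_type, Finset.sum_eq_single l]
    · rw [tupleOfCoeffs, Finset.sum_mul]
      refine Finset.sum_congr rfl fun a _ => ?_
      rw [if_pos rfl, ← smul_mul_assoc, MvPolynomial.smul_monomial, smul_eq_mul, mul_one]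
    · intro b _ hb
      simp [hb]
    · simp
  rw [key, key, ← Finset.sum_sub_distrib, MvPolynomial.coeff_sum, dotProduct]
  refine Finset.sum_congr rfl fun c _ => ?_
  rw [← smul_sub, ← mul_sub, MvPolynomial.coeff_smul, smul_eq_mul, mul_comm]
  rfl

theorem proportionalityEquation_map (φ : R →+* S)
    (g : Fin (n + 1) → MvPolynomial (Fin (n + 1)) R) (d : ℕ)
    (r : Fin (n + 1) × Fin (n + 1) × (Fin (n + 1) →₀ ℕ)) (c : CoeffIndex n d) :
    proportionalityEquation (fun i => MvPolynomial.map φ (g i)) d r c =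
      φ (proportionalityEquation g d r c) := by
  unfold proportionalityEquation
  rw [← MvPolynomial.coeff_map, map_mul, map_sub, MvPolynomial.map_monomial, map_one φ]
  simp only [apply_ite (MvPolynomial.map φ), map_zero]

/-- The maximal minors of the system of linear equations for the tuples proportional to `g`. -/
def proportionalityMinor (g : Fin (n + 1) → MvPolynomial (Fin (n + 1)) R) (d : ℕ)
    (f : CoeffIndex n d → Fin (n + 1) × Fin (n + 1) × (Fin (n + 1) →₀ ℕ)) : R :=
  (Matrix.of fun c => proportionalityEquation g d (f c)).det

/-- A nonzero solution may map to zero under a ring map, so `HasProportional` is hard to transport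
directly; the minors are transported by every ring map. -/
theorem proportionalityMinor_map (φ : R →+* S)
    (g : Fin (n + 1) → MvPolynomial (Fin (n + 1)) R) (d : ℕ)
    (f : CoeffIndex n d → Fin (n + 1) × Fin (n + 1) × (Fin (n + 1) →₀ ℕ)) :
    proportionalityMinor (fun i => MvPolynomial.map φ (g i)) d f =
      φ (proportionalityMinor g d f) := by
  rw [proportionalityMinor, proportionalityMinor, RingHom.map_det]
  congr 1
  ext c c'
  exact proportionalityEquation_map φ g d (f c) c'

theorem hasProportional_iff [IsDomain R] (g : Fin (n + 1) → MvPolynomial (Fin (n + 1)) R)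
    (d : ℕ) : HasProportional g d ↔ ∀ f, proportionalityMinor g d f = 0 := by
  refine Iff.trans ?_ (exists_ne_zero_forall_dotProduct_eq_zero_iff
    (proportionalityEquation g d))
  constructor
  · rintro ⟨F, hF, hF0, hFg⟩
    refine ⟨fun c => (F c.1).coeff c.2.1, fun h0 => hF0 ?_, ?_⟩
    · rw [← tupleOfCoeffs_coeff hF, h0]
      funext i
      simp [tupleOfCoeffs]
    · rintro ⟨i, j, β⟩
      rw [proportionalityEquation_dotProduct, tupleOfCoeffs_coeff hF, hFg i j, sub_self,
        MvPolynomial.coeff_zero]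
  · rintro ⟨w, hw, h⟩
    refine ⟨tupleOfCoeffs w, isHomogeneousTuple_tupleOfCoeffs w, fun h0 => hw ?_,
      fun i j => ?_⟩
    · funext c
      rw [← coeff_tupleOfCoeffs w c, h0]
      simp
    · rw [← sub_eq_zero]
      ext β
      rw [← proportionalityEquation_dotProduct, h, MvPolynomial.coeff_zero]

/-- Multiplication by a variable preserves proportionality, and nonvanishing too over a domain. -/
theorem HasProportional.succ [IsDomain R] {g : Fin (n + 1) → MvPolynomial (Fin (n + 1)) R}
    {d : ℕ} (h : HasProportional g d) : HasProportional g (d + 1) := by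
  obtain ⟨F, hF, hF0, hFg⟩ := h
  refine ⟨fun i => F i * MvPolynomial.X 0,
    fun i => (hF i).mul (MvPolynomial.isHomogeneous_X R 0), fun h0 => hF0 ?_, fun i j => ?_⟩
  · funext i
    exact (mul_eq_zero.1 (congrFun h0 i)).resolve_right (MvPolynomial.X_ne_zero 0)
  · rw [mul_right_comm, hFg, mul_right_comm]

theorem HasProportional.mono [IsDomain R] {g : Fin (n + 1) → MvPolynomial (Fin (n + 1)) R}
    {d e : ℕ} (h : HasProportional g d) (hde : d ≤ e) : HasProportional g e := by
  induction e, hde using Nat.le_induction with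
  | base => exact h
  | succ e _ ih => exact ih.succ

end Proportional

/-! ## The Zariski topology on projective space -/

section PSpace

variable {k : Type u} [Field k] {n : ℕ}

theorem PSpace.coords_ne_zero (x : PSpace k n) : x.coords ≠ 0 := Projectivization.rep_nonzero x

theorem PSpace.isOpen_ne_zero {d : ℕ} {G : MvPolynomial (Fin (n + 1)) k}
    (hG : G.IsHomogeneous d) : IsOpen {x : PSpace k n | MvPolynomial.eval x.coords G ≠ 0} :=
  TopologicalSpace.isOpen_generateFrom_of_mem ⟨d, G, hG, rfl⟩

/-- The generating sets form a basis because products of homogeneous polynomials are homogeneous. -/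
theorem PSpace.exists_homogeneous_of_isOpen {U : Set (PSpace k n)} (hU : IsOpen U)
    {x : PSpace k n} (hx : x ∈ U) :
    ∃ (d : ℕ) (G : MvPolynomial (Fin (n + 1)) k), G.IsHomogeneous d ∧
      MvPolynomial.eval x.coords G ≠ 0 ∧
        ∀ y : PSpace k n, MvPolynomial.eval y.coords G ≠ 0 → y ∈ U := by
  have hU' : TopologicalSpace.GenerateOpen {B | ∃ (d : ℕ) (G : MvPolynomial (Fin (n + 1)) k),
      G.IsHomogeneous d ∧ B = {x : PSpace k n | MvPolynomial.eval x.coords G ≠ 0}} U := hU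
  induction hU' with
  | basic B hB =>
    obtain ⟨d, G, hG, rfl⟩ := hB
    exact ⟨d, G, hG, hx, fun _ hy => hy⟩
  | univ => exact ⟨0, 1, MvPolynomial.isHomogeneous_one _ _, by simp, fun _ _ => trivial⟩
  | inter A B hA hB ihA ihB =>
    obtain ⟨d, G, hG, hGx, hGA⟩ := ihA hA hx.1
    obtain ⟨e, H, hH, hHx, hHB⟩ := ihB hB hx.2
    refine ⟨d + e, G * H, hG.mul hH, by simp [hGx, hHx], fun y hy => ?_⟩
    rw [map_mul] at hy
    exact ⟨hGA y (left_ne_zero_of_mul hy), hHB y (right_ne_zero_of_mul hy)⟩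
  | sUnion 𝒮 h𝒮 ih =>
    obtain ⟨A, hA, hxA⟩ := hx
    obtain ⟨d, G, hG, hGx, hGA⟩ := ih A hA (h𝒮 A hA) hxA
    exact ⟨d, G, hG, hGx, fun y hy => ⟨A, hA, hGA y hy⟩⟩

theorem eval_smul_of_isHomogeneous {R : Type*} [CommRing R] {σ : Type*}
    {G : MvPolynomial σ R} {d : ℕ} (hG : G.IsHomogeneous d) (c : R) (v : σ → R) :
    MvPolynomial.eval (c • v) G = c ^ d * MvPolynomial.eval v G := by
  simp only [MvPolynomial.eval_eq, Finset.mul_sum, Pi.smul_apply, smul_eq_mul]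
  refine Finset.sum_congr rfl fun α hα => ?_
  have hd : α.degree = d := by
    by_contra h
    exact MvPolynomial.mem_support_iff.1 hα (hG.coeff_eq_zero h)
  simp only [mul_pow, Finset.prod_mul_distrib, Finset.prod_pow_eq_pow_sum]
  rw [show ∑ i ∈ α.support, α i = d from hd]
  ring

/-- A nonzero homogeneous polynomial over an infinite field does not vanish at some point of
projective space. -/
theorem PSpace.exists_eval_coords_ne_zero [Infinite k] {d : ℕ}
    {G : MvPolynomial (Fin (n + 1)) k} (hG : G.IsHomogeneous d) (h0 : G ≠ 0) :
    ∃ x : PSpace k n, MvPolynomial.eval x.coords G ≠ 0 := by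
  by_contra! h
  -- The factor `X 0` takes care of the origin, which is no point of projective space and where a
  -- constant `G` need not vanish.
  have hX : G * MvPolynomial.X 0 = 0 := by
    refine MvPolynomial.funext fun v => ?_
    rw [map_mul, map_zero, MvPolynomial.eval_X]
    by_cases hv : v = 0
    · simp [hv]
    · obtain ⟨a, ha⟩ := Projectivization.exists_smul_eq_mk_rep k v hv
      have h1 : MvPolynomial.eval (((a : k)) • v) G = 0 := by
        have h2 : MvPolynomial.eval (Projectivization.mk k v hv).rep G = 0 :=
          h (Projectivization.mk k v hv)
        rwa [← ha, Units.smul_def] at h2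
      rw [eval_smul_of_isHomogeneous hG] at h1
      rw [(mul_eq_zero.1 h1).resolve_left (pow_ne_zero _ a.ne_zero), zero_mul]
  exact h0 ((mul_eq_zero.1 hX).resolve_right (MvPolynomial.X_ne_zero 0))

theorem PSpace.exists_mem_eval_coords_ne_zero [Infinite k] {U : Set (PSpace k n)}
    (hU : IsOpen U) (hU0 : U.Nonempty) {d : ℕ} {G : MvPolynomial (Fin (n + 1)) k}
    (hG : G.IsHomogeneous d) (h0 : G ≠ 0) : ∃ x ∈ U, MvPolynomial.eval x.coords G ≠ 0 := by
  obtain ⟨x, hx⟩ := hU0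
  obtain ⟨e, H, hH, hHx, hHU⟩ := PSpace.exists_homogeneous_of_isOpen hU hx
  have hH0 : H ≠ 0 := by
    rintro rfl
    simp at hHx
  obtain ⟨y, hy⟩ := PSpace.exists_eval_coords_ne_zero (hG.mul hH) (mul_ne_zero h0 hH0)
  rw [map_mul] at hy
  exact ⟨y, hHU y (right_ne_zero_of_mul hy), left_ne_zero_of_mul hy⟩

theorem PSpace.inter_nonempty [Infinite k] {U W : Set (PSpace k n)} (hU : IsOpen U)
    (hU0 : U.Nonempty) (hW : IsOpen W) (hW0 : W.Nonempty) : (U ∩ W).Nonempty := by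
  obtain ⟨x, hx⟩ := hU0
  obtain ⟨e, H, hH, hHx, hHU⟩ := PSpace.exists_homogeneous_of_isOpen hU hx
  obtain ⟨y, hy, hyH⟩ := PSpace.exists_mem_eval_coords_ne_zero hW hW0 hH
    (by rintro rfl; simp at hHx)
  exact ⟨y, hHU y hyH, hy⟩

/-! ### Degree of a rational map in terms of proportional tuples -/

theorem RepresentsAt.mul_eq_mul {F G : Fin (n + 1) → MvPolynomial (Fin (n + 1)) k}
    {x y : PSpace k n} (hF : RepresentsAt F x y) (hG : RepresentsAt G x y) (i j : Fin (n + 1)) :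
    MvPolynomial.eval x.coords (F i) * MvPolynomial.eval x.coords (G j) =
      MvPolynomial.eval x.coords (F j) * MvPolynomial.eval x.coords (G i) := by
  obtain ⟨hF0, hFy⟩ := hF
  obtain ⟨hG0, hGy⟩ := hG
  obtain ⟨a, ha⟩ := (Projectivization.mk_eq_mk_iff' k _ _ hF0 hG0).1 (hFy.symm.trans hGy)
  have hi := congrFun ha i
  have hj := congrFun ha j
  simp only [Pi.smul_apply, smul_eq_mul] at hi hj
  rw [← hi, ← hj]
  ring

theorem RepresentsAt.of_mul_eq_mul {F G : Fin (n + 1) → MvPolynomial (Fin (n + 1)) k}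
    {x y : PSpace k n} (hG : RepresentsAt G x y)
    (h : ∀ i j, F i * G j = F j * G i) {i : Fin (n + 1)}
    (hF0 : MvPolynomial.eval x.coords (F i) ≠ 0) : RepresentsAt F x y := by
  obtain ⟨hG0, rfl⟩ := hG
  have hF : (fun i => MvPolynomial.eval x.coords (F i)) ≠ 0 := fun h0 => hF0 (congrFun h0 i)
  have h' (j l) : MvPolynomial.eval x.coords (F j) * MvPolynomial.eval x.coords (G l) =
      MvPolynomial.eval x.coords (F l) * MvPolynomial.eval x.coords (G j) := by
    rw [← map_mul, h, map_mul]
  refine ⟨hF, (Projectivization.mk_eq_mk_iff' k _ _ hG0 hF).2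
    ⟨MvPolynomial.eval x.coords (G i) / MvPolynomial.eval x.coords (F i), funext fun j => ?_⟩⟩
  simp only [Pi.smul_apply, smul_eq_mul]
  rw [div_mul_eq_mul_div, div_eq_iff hF0, mul_comm, h', mul_comm]

/-- Nonempty open sets meet, so the cross products of two defining tuples agree on a nonempty open
set and hence as polynomials. No common factor has to be cancelled. -/
theorem RationalSelfMap.exists_isDefinedBy_iff [Infinite k] (f : RationalSelfMap k n)
    {g : Fin (n + 1) → MvPolynomial (Fin (n + 1)) k} {e : ℕ} (hg : f.IsDefinedBy g e) (d : ℕ) :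
    (∃ F, f.IsDefinedBy F d) ↔ HasProportional g d := by
  obtain ⟨hgh, W, hWf, hW, hW0, hWg⟩ := hg
  constructor
  · rintro ⟨F, hF, W', hWf', hW', hW0', hWF⟩
    refine ⟨F, hF, ?_, fun i j => ?_⟩
    · rintro rfl
      obtain ⟨x, hx⟩ := hW0'
      obtain ⟨h, -⟩ := hWF x hx
      exact h (funext fun i => by simp)
    · by_contra hne
      obtain ⟨x, hx, hx0⟩ := PSpace.exists_mem_eval_coords_ne_zero (hW.inter hW')
        (PSpace.inter_nonempty hW hW0 hW' hW0')
        (((hF i).mul (hgh j)).sub ((hF j).mul (hgh i))) (sub_ne_zero.2 hne)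
      apply hx0
      rw [map_sub, map_mul, map_mul, (hWF x hx.2).mul_eq_mul (hWg x hx.1), sub_self]
  · rintro ⟨F, hF, hF0, hFg⟩
    obtain ⟨i, hi⟩ := Function.ne_iff.1 hF0
    refine ⟨F, hF, W ∩ {x | MvPolynomial.eval x.coords (F i) ≠ 0},
      Set.inter_subset_left.trans hWf, hW.inter (PSpace.isOpen_ne_zero (hF i)), ?_, ?_⟩
    · exact PSpace.exists_mem_eval_coords_ne_zero hW hW0 (hF i) hi
    · exact fun x hx => (hWg x hx.1).of_mul_eq_mul hFg hx.2

theorem RationalSelfMap.IsDefinedBy.degree_le {f : RationalSelfMap k n}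
    {F : Fin (n + 1) → MvPolynomial (Fin (n + 1)) k} {d : ℕ} (hF : f.IsDefinedBy F d) :
    f.degree ≤ d :=
  Nat.sInf_le (s := {d | ∃ F, f.IsDefinedBy F d}) ⟨F, hF⟩

theorem RationalSelfMap.degree_le_iff [Infinite k] (f : RationalSelfMap k n)
    {g : Fin (n + 1) → MvPolynomial (Fin (n + 1)) k} {e : ℕ} (hg : f.IsDefinedBy g e) (d : ℕ) :
    f.degree ≤ d ↔ HasProportional g d := by
  refine ⟨fun h => ?_, fun h => ?_⟩
  swap
  · obtain ⟨F, hF⟩ := (f.exists_isDefinedBy_iff hg d).2 h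
    exact hF.degree_le
  -- The tuple `g` makes the set of degrees nonempty, so the infimum is attained and is not the
  -- default `0`.
  have hmem : ∃ F, f.IsDefinedBy F f.degree :=
    Nat.sInf_mem (s := {d | ∃ F, f.IsDefinedBy F d}) ⟨e, g, hg⟩
  exact ((f.exists_isDefinedBy_iff hg _).1 hmem).mono h

end PSpace

/-! ## Functions and points of a variety -/

section Points

variable {k : Type u} [Field k] {T : Scheme.{u}} {s : T ⟶ Spec (.of k)}

theorem Points.isOpen_preimage (V : T.Opens) : IsOpen {t : Points s | t.pt ∈ V} :=
  isOpen_induced V.isOpen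

/-- A function on `Spec k` is zero or a unit, so its basic open set is empty or everything. -/
theorem evalAt_ne_zero_iff (t : Points s) {V : T.Opens} (h : t.pt ∈ V) (a : Γ(T, V)) :
    evalAt t V h a ≠ 0 ↔ t.pt ∈ T.basicOpen a := by
  let b : Γ(Spec (.of k), ⊤) := t.1.appLE V ⊤ (t.top_le_preimage h) a
  have h1 : (Spec (.of k)).basicOpen b = ⊤ ⊓ t.1 ⁻¹ᵁ T.basicOpen a :=
    Scheme.basicOpen_appLE t.1 ⊤ V (t.top_le_preimage h) a
  have h2 : t.pt ∈ T.basicOpen a ↔ (IsLocalRing.closedPoint k : Spec (.of k)) ∈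
      (Spec (.of k)).basicOpen b := by
    rw [h1]
    exact ⟨fun hx => ⟨trivial, hx⟩, fun hx => hx.2⟩
  let e := (Scheme.ΓSpecIso (.of k)).commRingCatIsoToRingEquiv
  have h3 : evalAt t V h a = e b := rfl
  rw [h2, h3]
  refine ⟨fun hb => ?_, fun hb h0 => ?_⟩
  · have hu : IsUnit b := (MulEquiv.isUnit_map e).1 hb.isUnit
    rw [Scheme.basicOpen_of_isUnit _ hu]
    trivial
  · rw [(map_eq_zero_iff e e.injective).1 h0, Scheme.basicOpen_zero] at hb
    exact hb

theorem evalAt_map (t : Points s) {U V : T.Opens} (hUV : U ≤ V) (h : t.pt ∈ U) (a : Γ(T, V)) :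
    evalAt t U h (T.presheaf.map (homOfLE hUV).op a) = evalAt t V (hUV h) a := by
  have := Scheme.Hom.map_appLE t.1 (t.top_le_preimage h) (homOfLE hUV).op
  unfold evalAt
  rw [← this]
  rfl

/-- The restriction to `U` of a polynomial with coefficients in the functions on `V`. -/
def restrictPoly {n : ℕ} {U V : T.Opens} (hUV : U ≤ V)
    (G : MvPolynomial (Fin (n + 1)) Γ(T, V)) : MvPolynomial (Fin (n + 1)) Γ(T, U) :=
  MvPolynomial.map (T.presheaf.map (homOfLE hUV).op).hom G

theorem specialize_restrictPoly {n : ℕ} (t : Points s) {U V : T.Opens} (hUV : U ≤ V)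
    (h : t.pt ∈ U) (G : MvPolynomial (Fin (n + 1)) Γ(T, V)) :
    specialize t U h (restrictPoly hUV G) = specialize t V (hUV h) G := by
  rw [specialize, restrictPoly, MvPolynomial.map_map, specialize]
  congr 2
  exact RingHom.ext fun a => evalAt_map t hUV h a

/-- Closed points are dense in a Jacobson scheme, and over an algebraically closed field they are
`k`-points. -/
theorem Points.exists_pt_mem [IsAlgClosed k] [LocallyOfFiniteType s] (V : T.Opens)
    (hV : (V : Set T).Nonempty) : ∃ t : Points s, t.pt ∈ V := by
  have : JacobsonSpace T := LocallyOfFiniteType.jacobsonSpace s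
  have hdense : Dense (closedPoints T) := dense_iff_closure_eq.2 closure_closedPoints
  obtain ⟨x, hxV, hx⟩ := hdense.inter_open_nonempty _ V.isOpen hV
  refine ⟨(pointEquivClosedPoint s).symm ⟨x, hx⟩, ?_⟩
  have : Points.pt (s := s) ((pointEquivClosedPoint s).symm ⟨x, hx⟩) = x :=
    congrArg Subtype.val ((pointEquivClosedPoint s).apply_symm_apply ⟨x, hx⟩)
  rwa [this]

/-- The inclusion of the constants into the functions on `V`. -/
def constants (s : T ⟶ Spec (.of k)) (V : T.Opens) : k →+* Γ(T, V) :=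
  ((Scheme.ΓSpecIso (.of k)).inv ≫ s.appLE ⊤ V (show V ≤ s ⁻¹ᵁ ⊤ from le_top)).hom

theorem evalAt_constants (t : Points s) {V : T.Opens} (h : t.pt ∈ V) (c : k) :
    evalAt t V h (constants s V c) = c := by
  have h0 : s.appLE ⊤ V (show V ≤ s ⁻¹ᵁ ⊤ from le_top) ≫
      t.1.appLE V ⊤ (t.top_le_preimage h) = 𝟙 _ := by
    rw [Scheme.Hom.appLE_comp_appLE]
    simp only [t.2]
    exact (Scheme.Hom.app_eq_appLE (𝟙 _)).symm.trans (Scheme.Hom.id_app _)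
  have h1 : ((Scheme.ΓSpecIso (.of k)).inv ≫ s.appLE ⊤ V (show V ≤ s ⁻¹ᵁ ⊤ from le_top)) ≫
      (t.1.appLE V ⊤ (t.top_le_preimage h) ≫ (Scheme.ΓSpecIso (.of k)).hom) = 𝟙 _ := by
    rw [Category.assoc, reassoc_of% h0, Iso.inv_hom_id]
  exact congrArg (fun f => f.hom c) h1

/-- A nonzero function does not vanish at some point of every nonempty open set. -/
theorem exists_evalAt_ne_zero [IsAlgClosed k] [LocallyOfFiniteType s] [IsIntegral T]
    {U V : T.Opens} (hU : (U : Set T).Nonempty) {a : Γ(T, V)} (ha : a ≠ 0) :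
    ∃ (t : Points s) (h : t.pt ∈ V), t.pt ∈ U ∧ evalAt t V h a ≠ 0 := by
  -- As `T` is reduced, only the zero function has an empty basic open set.
  have hne : ((T.basicOpen a : T.Opens) : Set T).Nonempty := by
    rw [Set.nonempty_iff_ne_empty]
    intro h0
    exact ha ((basicOpen_eq_bot_iff a).1 (TopologicalSpace.Opens.ext h0))
  obtain ⟨t, ht⟩ := Points.exists_pt_mem (s := s) (T.basicOpen a ⊓ U)
    (nonempty_preirreducible_inter (T.basicOpen a).isOpen U.isOpen hne hU)
  have h : t.pt ∈ V := T.basicOpen_le a ht.1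
  exact ⟨t, h, ht.2, (evalAt_ne_zero_iff t h a).2 ht.1⟩

end Points

/-! ## The topology of the product -/

section RelPSpace

variable {k : Type u} [Field k] {T : Scheme.{u}} {s : T ⟶ Spec (.of k)} {n : ℕ}

theorem RelPSpace.isOpen_ne_zero {V : T.Opens} {d : ℕ}
    {G : MvPolynomial (Fin (n + 1)) Γ(T, V)} (hG : G.IsHomogeneous d) :
    IsOpen {p : RelPSpace s n | ∃ h : p.base.pt ∈ V,
      MvPolynomial.eval p.fib.coords (specialize p.base V h G) ≠ 0} :=
  TopologicalSpace.isOpen_generateFrom_of_mem ⟨V, d, G, hG, rfl⟩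

/-- Substituting the constant coordinates of `x` into `G` gives a function on `V`; the slice of a
basic open set is where it is nonzero. -/
theorem continuous_mk_left (x : PSpace k n) :
    Continuous (fun t : Points s => (⟨t, x⟩ : RelPSpace s n)) := by
  refine continuous_generateFrom_iff.2 ?_
  rintro B ⟨V, d, G, hG, rfl⟩
  have heq : (fun t : Points s => (⟨t, x⟩ : RelPSpace s n)) ⁻¹'
      {p | ∃ h : p.base.pt ∈ V, MvPolynomial.eval p.fib.coords (specialize p.base V h G) ≠ 0} =
      {t | t.pt ∈ T.basicOpen (MvPolynomial.eval (fun i => constants s V (x.coords i)) G)} := by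
    ext t
    have key (h : t.pt ∈ V) : MvPolynomial.eval x.coords (specialize t V h G) =
        evalAt t V h (MvPolynomial.eval (fun i => constants s V (x.coords i)) G) := by
      rw [specialize, MvPolynomial.eval_map, MvPolynomial.eval, MvPolynomial.coe_eval₂Hom,
        MvPolynomial.hom_eval₂]
      simp only [RingHom.comp_id, evalAt_constants]
    constructor
    · rintro ⟨h, ht⟩
      exact (evalAt_ne_zero_iff t h _).1 (key h ▸ ht)
    · intro ht
      have h : t.pt ∈ V := T.basicOpen_le _ ht
      exact ⟨h, fun h0 => (evalAt_ne_zero_iff t h _).2 ht ((key h).symm.trans h0)⟩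
  rw [heq]
  exact Points.isOpen_preimage _

/-- The points at which a set of the form `{t | (t, x) ∈ W}` contains a given one admit an open
neighbourhood in the scheme. -/
theorem exists_opens_of_isOpen {W : Set (RelPSpace s n)} (hW : IsOpen W) {t₀ : Points s}
    {x : PSpace k n} (h : (⟨t₀, x⟩ : RelPSpace s n) ∈ W) :
    ∃ V : T.Opens, t₀.pt ∈ V ∧ ∀ t : Points s, t.pt ∈ V → (⟨t, x⟩ : RelPSpace s n) ∈ W := by
  obtain ⟨V, hV, hVW⟩ := isOpen_induced_iff.1 (hW.preimage (continuous_mk_left x))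
  refine ⟨⟨V, hV⟩, ?_, fun t ht => ?_⟩
  · change t₀ ∈ Points.pt ⁻¹' V
    rw [hVW]
    exact h
  · have : t ∈ Points.pt ⁻¹' V := ht
    rw [hVW] at this
    exact this

theorem RelPSpace.isOpen_base_mem (V : T.Opens) :
    IsOpen {p : RelPSpace s n | p.base.pt ∈ V} := by
  convert RelPSpace.isOpen_ne_zero (s := s) (n := n) (V := V)
    (MvPolynomial.isHomogeneous_one (Fin (n + 1)) Γ(T, V)) using 1
  ext p
  simp [specialize]

end RelPSpace

/-! ### Degrees of the members of a family, and writings -/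

namespace RationalFamily

variable {k : Type u} [Field k] {T : Scheme.{u}} {s : T ⟶ Spec (.of k)} {n : ℕ}

/-- The tuple `g` defines `φ_t` for all `t` in the open set `V`. -/
def IsWritingOverAll (φ : RationalFamily s n) (V : T.Opens)
    (g : Fin (n + 1) → MvPolynomial (Fin (n + 1)) Γ(T, V)) (e : ℕ) : Prop :=
  IsHomogeneousTuple g e ∧ ∃ W ⊆ φ.domain, IsOpen W ∧ RepresentsOn φ.toFun W V g ∧
    ∀ t : Points s, t.pt ∈ V → (section_ W t).Nonempty

/-- Density of the section over `t₀` provides a point `x`; the same `x` remains in the sections of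
`W` over all nearby `t`. -/
theorem exists_isWritingOverAll (φ : RationalFamily s n) (t₀ : Points s) :
    ∃ (V : T.Opens) (e : ℕ) (g : Fin (n + 1) → MvPolynomial (Fin (n + 1)) Γ(T, V)),
      IsAffineOpen V ∧ t₀.pt ∈ V ∧ φ.IsWritingOverAll V g e := by
  obtain ⟨x, hx⟩ : (section_ φ.domain t₀).Nonempty := by
    have : Nonempty (PSpace k n) :=
      inferInstanceAs (Nonempty (Projectivization k (Fin (n + 1) → k)))
    exact (φ.dense_section t₀).nonempty
  obtain ⟨W, hWφ, hxW, hW, V₁, e, g, hg, hWg⟩ := φ.isRegularOn _ hx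
  obtain ⟨V₂, ht₂, hV₂⟩ := exists_opens_of_isOpen hW hxW
  obtain ⟨ht₁, -⟩ := hWg _ hxW
  obtain ⟨V, hV, htV, hVV⟩ := exists_isAffineOpen_mem_and_subset (U := V₁ ⊓ V₂) ⟨ht₁, ht₂⟩
  have hV₁ : V ≤ V₁ := fun y hy => (hVV hy).1
  refine ⟨V, e, fun i => restrictPoly hV₁ (g i), hV, htV, fun i => (hg i).map _,
    W ∩ {p | p.base.pt ∈ V}, Set.inter_subset_left.trans hWφ,
    hW.inter (RelPSpace.isOpen_base_mem V), ?_, fun t ht => ⟨x, hV₂ t (hVV ht).2, ht⟩⟩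
  rintro p ⟨hp, hpV⟩
  refine ⟨hpV, ?_⟩
  simp only [specialize_restrictPoly]
  obtain ⟨_, h⟩ := hWg p hp
  exact h

variable {φ : RationalFamily s n} {V : T.Opens}
  {g : Fin (n + 1) → MvPolynomial (Fin (n + 1)) Γ(T, V)} {e : ℕ}

theorem isDefinedBy_specialize {W : Set (RelPSpace s n)} (hWφ : W ⊆ φ.domain) (hW : IsOpen W)
    (hg : IsHomogeneousTuple g e) (hWg : RepresentsOn φ.toFun W V g) {t : Points s}
    (ht : t.pt ∈ V) (hWt : (section_ W t).Nonempty) :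
    (φ.fiber t).IsDefinedBy (fun i => specialize t V ht (g i)) e := by
  refine ⟨fun i => isHomogeneous_specialize t V ht (hg i), section_ W t, fun x hx => hWφ hx,
    isOpen_section hW t, hWt, fun x hx => ?_⟩
  obtain ⟨_, h⟩ := hWg _ hx
  exact h

theorem IsWritingOverAll.degree_fiber_le_iff [Infinite k] (hg : φ.IsWritingOverAll V g e)
    {t : Points s} (ht : t.pt ∈ V) (d : ℕ) :
    (φ.fiber t).degree ≤ d ↔ ∀ f, evalAt t V ht (proportionalityMinor g d f) = 0 := by
  obtain ⟨hgh, W, hWφ, hW, hWg, hWV⟩ := hg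
  rw [(φ.fiber t).degree_le_iff (isDefinedBy_specialize hWφ hW hgh hWg ht (hWV t ht)),
    hasProportional_iff]
  simp only [specialize, proportionalityMinor_map]

/-- A minor that is nonzero at `t₀` stays nonzero nearby. -/
theorem isOpen_lt_degree_fiber [Infinite k] (φ : RationalFamily s n) (d : ℕ) :
    IsOpen {t : Points s | d < (φ.fiber t).degree} := by
  rw [isOpen_iff_forall_mem_open]
  intro t₀ ht₀
  obtain ⟨V, e, g, -, htV, hg⟩ := φ.exists_isWritingOverAll t₀
  have h₀ : ¬ (φ.fiber t₀).degree ≤ d := Nat.not_le.2 ht₀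
  rw [hg.degree_fiber_le_iff htV] at h₀
  push Not at h₀
  obtain ⟨f, hf⟩ := h₀
  refine ⟨{t | t.pt ∈ T.basicOpen (proportionalityMinor g d f)}, fun t ht => ?_,
    Points.isOpen_preimage _, (evalAt_ne_zero_iff t₀ htV _).1 hf⟩
  have htV' : t.pt ∈ V := T.basicOpen_le _ ht
  refine Nat.not_le.1 fun hle => ?_
  exact (evalAt_ne_zero_iff t htV' _).2 ht ((hg.degree_fiber_le_iff htV' d).1 hle f)

variable [IsAlgClosed k] [LocallyOfFiniteType s] [IsIntegral T]

theorem IsWritingOverAll.exists_isWriting (hg : φ.IsWritingOverAll V g e)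
    (hV : IsAffineOpen V) (hV0 : (V : Set T).Nonempty) {d : ℕ}
    (hd : ∀ t : Points s, t.pt ∈ V → (φ.fiber t).degree ≤ d) : ∃ F, φ.IsWriting V F d := by
  have := IsAlgClosed.instInfinite (K := k)
  have : Nonempty V := hV0.to_subtype
  have hprop : HasProportional g d := by
    rw [hasProportional_iff]
    intro f
    by_contra hf
    obtain ⟨t, ht, -, h⟩ := exists_evalAt_ne_zero (s := s) hV0 hf
    exact h ((hg.degree_fiber_le_iff ht d).1 (hd t ht) f)
  obtain ⟨F, hF, hF0, hFg⟩ := hprop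
  obtain ⟨hgh, W, hWφ, hW, hWg, hWV⟩ := hg
  obtain ⟨i, hi⟩ := Function.ne_iff.1 hF0
  -- `F` may specialize to zero at some points; a `t` where one coefficient survives shows that the
  -- open set for the writing is nonempty.
  obtain ⟨α, hα⟩ := MvPolynomial.ne_zero_iff.1 hi
  obtain ⟨t, ht, -, h⟩ := exists_evalAt_ne_zero (s := s) hV0 hα
  have hne : specialize t V ht (F i) ≠ 0 :=
    MvPolynomial.ne_zero_iff.2 ⟨α, by rwa [specialize, MvPolynomial.coeff_map]⟩
  obtain ⟨x, hx, hx0⟩ := PSpace.exists_mem_eval_coords_ne_zero (isOpen_section hW t) (hWV t ht)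
    (isHomogeneous_specialize t V ht (hF i)) hne
  refine ⟨F, hV, hF, W ∩ {p | ∃ h : p.base.pt ∈ V,
      MvPolynomial.eval p.fib.coords (specialize p.base V h (F i)) ≠ 0},
    Set.inter_subset_left.trans hWφ, hW.inter (RelPSpace.isOpen_ne_zero (hF i)),
    ⟨⟨t, x⟩, hx, ht, hx0⟩, ?_⟩
  rintro p ⟨hp, hpV, hp0⟩
  obtain ⟨_, hpg⟩ := hWg p hp
  refine ⟨hpV, hpg.of_mul_eq_mul (fun j l => ?_) hp0⟩
  simp only [specialize, ← map_mul, hFg j l]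

/-- If `φ` has a writing of degree `d`, then all maps `φ_t` have degree at most `d`. -/
theorem IsWriting.degree_fiber_le {V' : T.Opens}
    {F : Fin (n + 1) → MvPolynomial (Fin (n + 1)) Γ(T, V')} {d : ℕ} (hF : φ.IsWriting V' F d)
    (t₀ : Points s) : (φ.fiber t₀).degree ≤ d := by
  have := IsAlgClosed.instInfinite (K := k)
  obtain ⟨-, hFh, W, hWφ, hW, ⟨⟨t₁, x⟩, hx⟩, hWF⟩ := hF
  obtain ⟨V₁, ht₁, hV₁⟩ := exists_opens_of_isOpen hW hx
  obtain ⟨V, e, g, -, htV, hg⟩ := φ.exists_isWritingOverAll t₀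
  rw [hg.degree_fiber_le_iff htV]
  intro f
  by_contra hf
  have hf0 : proportionalityMinor g d f ≠ 0 := fun h0 => hf (by rw [h0, map_zero])
  -- By irreducibility the minor is also nonzero at some `t` in `V₁`, where the writing specializes
  -- and bounds the degree by `d`.
  obtain ⟨t, ht, htV₁, h⟩ := exists_evalAt_ne_zero (s := s) (U := V₁) ⟨_, ht₁⟩ hf0
  obtain ⟨ht', -⟩ := hWF _ (hV₁ t htV₁)
  exact h ((hg.degree_fiber_le_iff ht d).1
    (isDefinedBy_specialize hWφ hW hFh hWF ht' ⟨x, hV₁ t htV₁⟩).degree_le f)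

theorem exists_isWriting_of_forall_degree_fiber_le {d : ℕ}
    (hd : ∀ t : Points s, (φ.fiber t).degree ≤ d) :
    ∃ (V : T.Opens) (F : Fin (n + 1) → MvPolynomial (Fin (n + 1)) Γ(T, V)),
      (V : Set T).Nonempty ∧ φ.IsWriting V F d := by
  obtain ⟨t, -⟩ := Points.exists_pt_mem (s := s) ⊤ Set.univ_nonempty
  obtain ⟨V, e, g, hV, htV, hg⟩ := φ.exists_isWritingOverAll t
  obtain ⟨F, hF⟩ := hg.exists_isWriting hV ⟨_, htV⟩ fun t _ => hd t
  exact ⟨V, F, ⟨_, htV⟩, hF⟩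

/-- A local tuple of degree `e` yields a writing of degree `e`, which bounds the degree globally.
Thus the infimum defining `Deg` runs over a nonempty set. -/
theorem exists_forall_degree_fiber_le (φ : RationalFamily s n) :
    ∃ d : ℕ, ∀ t : Points s, (φ.fiber t).degree ≤ d := by
  have := IsAlgClosed.instInfinite (K := k)
  obtain ⟨t₀, -⟩ := Points.exists_pt_mem (s := s) ⊤ Set.univ_nonempty
  obtain ⟨V, e, g, hV, htV, hg⟩ := φ.exists_isWritingOverAll t₀
  have hle : ∀ t : Points s, t.pt ∈ V → (φ.fiber t).degree ≤ e := fun t ht => by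
    obtain ⟨hgh, W, hWφ, hW, hWg, hWV⟩ := hg
    exact (isDefinedBy_specialize hWφ hW hgh hWg ht (hWV t ht)).degree_le
  obtain ⟨F, hF⟩ := hg.exists_isWriting hV ⟨_, htV⟩ hle
  exact ⟨e, hF.degree_fiber_le⟩

theorem degree_fiber_le_Deg (φ : RationalFamily s n) (t : Points s) :
    (φ.fiber t).degree ≤ φ.Deg := by
  obtain ⟨d, hd⟩ := φ.exists_forall_degree_fiber_le
  obtain ⟨V, F, -, hF⟩ := Nat.sInf_mem (s := {d | ∃ (V : T.Opens)
    (F : Fin (n + 1) → MvPolynomial (Fin (n + 1)) Γ(T, V)),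
      (V : Set T).Nonempty ∧ φ.IsWriting V F d})
    ⟨d, exists_isWriting_of_forall_degree_fiber_le hd⟩
  exact hF.degree_fiber_le t

theorem exists_degree_fiber_eq_Deg (φ : RationalFamily s n) :
    ∃ t : Points s, (φ.fiber t).degree = φ.Deg := by
  by_contra! h
  have hlt (t : Points s) : (φ.fiber t).degree < φ.Deg :=
    lt_of_le_of_ne (φ.degree_fiber_le_Deg t) (h t)
  obtain ⟨t₀, -⟩ := Points.exists_pt_mem (s := s) ⊤ Set.univ_nonempty
  -- Positivity makes `φ.Deg - 1` a genuine predecessor; a writing of that degree contradicts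
  -- minimality.
  have hpos : 0 < φ.Deg := (Nat.zero_le _).trans_lt (hlt t₀)
  have := Nat.sInf_le (s := {d | ∃ (V : T.Opens)
    (F : Fin (n + 1) → MvPolynomial (Fin (n + 1)) Γ(T, V)),
      (V : Set T).Nonempty ∧ φ.IsWriting V F d}) (exists_isWriting_of_forall_degree_fiber_le
    fun t => Nat.le_sub_one_of_lt (hlt t))
  change φ.Deg ≤ φ.Deg - 1 at this
  omega

end RationalFamily

/-- The nonempty fibres of a bounded lower semicontinuous function to `ℕ` form a finite
stratification. -/
theorem exists_stratification_of_lowerSemicontinuous {X : Type*} [TopologicalSpace X]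
    {f : X → ℕ} (hf : LowerSemicontinuous f) {D : ℕ} (hD : ∀ x, f x ≤ D) :
    ∃ (l : ℕ) (V : Fin l → Set X), (∀ j, IsLocallyClosed (V j)) ∧ (∀ j, (V j).Nonempty) ∧
      Pairwise (fun i j => Disjoint (V i) (V j)) ∧ (⋃ j, V j) = Set.univ ∧
      ∀ j, ∃ d : ℕ, ∀ x ∈ V j, f x = d := by
  have hfin : (Set.range f).Finite :=
    (Set.finite_Iic D).subset (Set.range_subset_iff.2 hD)
  obtain ⟨l, v, hv, hrange⟩ := hfin.fin_param
  refine ⟨l, fun j => f ⁻¹' {v j}, fun j => ?_, fun j => ?_, fun i j hij => ?_, ?_,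
    fun j => ⟨v j, fun x hx => hx⟩⟩
  · have hcl : IsClosed (f ⁻¹' Set.Iic (v j)) := hf.isClosed_preimage _
    -- A positive value `v j` is singled out by `v j - 1 < f x` and `f x ≤ v j`; truncated
    -- subtraction rules this out for `0`.
    rcases Nat.eq_zero_or_pos (v j) with h0 | hpos
    · convert hcl.isLocallyClosed using 1
      ext x
      simp [h0]
    · convert (hf.isOpen_preimage (v j - 1)).isLocallyClosed.inter hcl.isLocallyClosed using 1
      ext x
      simp only [Set.mem_preimage, Set.mem_singleton_iff, Set.mem_inter_iff, Set.mem_Ioi,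
        Set.mem_Iic]
      omega
  · obtain ⟨x, hx⟩ : v j ∈ Set.range f := hrange ▸ Set.mem_range_self j
    exact ⟨x, hx⟩
  · exact Disjoint.preimage f (Set.disjoint_singleton.2 (hv.ne hij))
  · refine Set.eq_univ_of_forall fun x => ?_
    obtain ⟨j, hj⟩ : f x ∈ Set.range v := hrange.symm ▸ Set.mem_range_self x
    exact Set.mem_iUnion.2 ⟨j, hj.symm⟩

end Cremona

end

theorem theorem28 {k : Type u} [Field k] [IsAlgClosed k] (n : ℕ)
    {T : Scheme.{u}} (s : T ⟶ Spec (.of k)) [IsIntegral T] [IsSeparated s]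
    [LocallyOfFiniteType s] [QuasiCompact s] (φ : Cremona.AlgebraicFamily s n) :
    (∃ (l : ℕ) (V : Fin l → Set (Cremona.Points s)),
      (∀ j, IsLocallyClosed (V j)) ∧ (∀ j, (V j).Nonempty) ∧
      Pairwise (fun i j => Disjoint (V i) (V j)) ∧ (⋃ j, V j) = Set.univ ∧
      ∀ j, ∃ d : ℕ, ∀ t ∈ V j, (φ.fiber t).degree = d) ∧
    LowerSemicontinuous (fun t : Cremona.Points s => (φ.fiber t).degree) ∧
    (∀ t : Cremona.Points s, (φ.fiber t).degree ≤ φ.Deg) ∧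
    IsOpen {t : Cremona.Points s | (φ.fiber t).degree = φ.Deg} ∧
    {t : Cremona.Points s | (φ.fiber t).degree = φ.Deg}.Nonempty := by
  have := IsAlgClosed.instInfinite (K := k)
  have hlsc : LowerSemicontinuous (fun t : Cremona.Points s => (φ.fiber t).degree) :=
    lowerSemicontinuous_iff_isOpen_preimage.2 fun d => φ.isOpen_lt_degree_fiber d
  refine ⟨Cremona.exists_stratification_of_lowerSemicontinuous hlsc φ.degree_fiber_le_Deg, hlsc,
    φ.degree_fiber_le_Deg, ?_, φ.exists_degree_fiber_eq_Deg⟩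
  -- Since `Deg` is an upper bound, equality means `Deg - 1 < deg φ_t`, an open condition, unless
  -- `Deg = 0`.
  rcases Nat.eq_zero_or_pos φ.Deg with h0 | hpos
  · convert isOpen_univ
    exact Set.eq_univ_of_forall fun t =>
      le_antisymm (φ.degree_fiber_le_Deg t) (h0 ▸ Nat.zero_le _)
  · convert φ.isOpen_lt_degree_fiber (φ.Deg - 1) using 1
    ext t
    have := φ.degree_fiber_le_Deg t
    simp only [Set.mem_ofPred_eq]
    omega
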